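/- Let $\Bbbk$ be an algebraically closed field of characteristic zero, $\mathfrak g$ a finite-dimensional semisimple Lie algebra over $\Bbbk$, $\mathfrak h$ a Cartan subalgebra, $R$ the root system of $(\mathfrak g,\mathfrak h)$, $\Pi$ a base of $R$, and $\mathfrak g^{\alpha}$ the root space of $\alpha\in R$. For $S\subseteq\Pi$ put $R_+^S=R\cap\mathbb N S$ and $R_-^S=-R_+^S$. If $S$ is connected (as a nonempty subset of the Dynkin diagram), let $\varepsilon_S$ be the highest root of the irreducible root system $R^S=R\cap\mathbb Z S$ with base $S$. Define a set $\mathcal K(S)$ of subsets of $S$ recursively by: $\mathcal K(\emptyset)=\emptyset$; $\mathcal K(S)=\mathcal K(S_1)\cup\dots\cup\mathcal K(S_r)$ if $S_1,\dots,S_r$ are the connected components of $S$; and $\mathcal K(S)=\{S\}\cup\mathcal K(\{\alpha\in S:\langle\alpha,\varepsilon_S^\vee\rangle=0\})$ if $S$ is connected. The index of a finite-dimensional Lie algebra $\mathfrak q$ is $\chi(\mathfrak q)=\min_{f\in\mathfrak q^*}\dim\{X\in\mathfrak q: f([X,Y])=0\ \text{for all } Y\in\mathfrak q\}$; $\mathfrak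 q$ is called Frobenius if $\chi(\mathfrak q)=0$. Let $S,T\subseteq\Pi$ and let $\mathfrak g_{S,T}=\mathfrak h\oplus\bigoplus_{\alpha\in R_+^S}\mathfrak g^\alpha\oplus\bigoplus_{\alpha\in R_-^T}\mathfrak g^\alpha$, a Lie subalgebra of $\mathfrak g$. If the family of roots consisting of the $\varepsilon_K$, $K\in\mathcal K(S)$, together with the $\varepsilon_L$, $L\in\mathcal K(T)$ (indexed by the disjoint union of $\mathcal K(S)$ and $\mathcal K(T)$, so that an element of both sets counts twice) is a basis of $\mathfrak h^*$, then $\mathfrak g_{S,T}$ is Frobenius, that is, $\chi(\mathfrak g_{S,T})=0$. -/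

import Mathlib

noncomputable section

namespace Seaweed

open Module LieAlgebra LieAlgebra.IsKilling

/-! ### The index of a Lie algebra -/

section Index

variable (K 𝔤 : Type*) [Field K] [LieRing 𝔤] [LieAlgebra K 𝔤]

/-- The alternating bilinear form `Φ_f(X, Y) = f([X, Y])` attached to a linear form `f`. -/
def bracketForm (f : Dual K 𝔤) : 𝔤 →ₗ[K] 𝔤 →ₗ[K] K :=
  LinearMap.mk₂ K (fun X Y => f ⁅X, Y⁆)
    (by simp) (by simp) (by simp) (by simp)

/-- The index of a (finite-dimensional) Lie algebra `𝔤`: the minimum over `f ∈ 𝔤^*` of the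
dimension of the kernel of `Φ_f`. -/
def index : ℕ :=
  ⨅ f : Dual K 𝔤, finrank K (LinearMap.ker (bracketForm K 𝔤 f))

end Index

/-! ### Subsets of simple roots -/

section Roots

variable {ι R M N : Type*} [CommRing R] [AddCommGroup M] [Module R M] [AddCommGroup N] [Module R N]
variable (P : RootPairing ι R M N)

/-- `R^S = R ∩ ℤS`. -/
def rootsOf (S : Set ι) : Set ι :=
  {i | P.root i ∈ AddSubgroup.closure (P.root '' S)}

/-- `R_+^S = R ∩ ℕS`. -/
def posRootsOf (S : Set ι) : Set ι :=
  {i | P.root i ∈ AddSubmonoid.closure (P.root '' S)}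

/-- `R_-^S`, the set of opposites of the elements of `R_+^S`. -/
def negRootsOf (S : Set ι) : Set ι :=
  {i | -P.root i ∈ AddSubmonoid.closure (P.root '' S)}

/-- The graph in which two distinct roots are joined when they are not orthogonal. Its restriction
to a base is the Dynkin graph. -/
def dynkinGraph : SimpleGraph ι :=
  SimpleGraph.fromRel fun i j => P.pairing i j ≠ 0

/-- `S` is connected (in particular nonempty). -/
def IsConn (S : Set ι) : Prop :=
  ((dynkinGraph P).induce S).Connected

/-- `C` is a connected component of `S`. -/
def IsComponent (S C : Set ι) : Prop :=
  Maximal (fun D => D ⊆ S ∧ IsConn P D) C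

/-- `θ` is the greatest root of `R^S`, for the order given by
`x ≤ y` if and only if `y - x ∈ ℕS`. -/
def IsHighestRoot (S : Set ι) (θ : ι) : Prop :=
  θ ∈ rootsOf P S ∧
    ∀ i ∈ rootsOf P S, P.root θ - P.root i ∈ AddSubmonoid.closure (P.root '' S)

open Classical in
/-- The highest root `ε_S` of `R^S` (for connected `S`; by convention it is `0` if there is no
greatest root, which does not happen for a connected set of simple roots). -/
def highestRoot (S : Set ι) : M :=
  if h : ∃ θ, IsHighestRoot P S θ then P.root h.choose else 0

/-- `IsCascade P S K` says that `K ∈ 𝒦(S)`. The three rules, read from `K` to `S`, are the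
recursive definition of `𝒦(S)`:
`𝒦(∅) = ∅` (no rule applies); `𝒦(S)` is the union of the `𝒦(C)`, for `C` a connected component
of `S`; and `𝒦(S) = {S} ∪ 𝒦({α ∈ S | ⟨α, ε_S^∨⟩ = 0})` if `S` is connected. -/
inductive IsCascade : Set ι → Set ι → Prop
  | self {S : Set ι} (hS : IsConn P S) : IsCascade S S
  | orthogonal {S K : Set ι} {θ : ι} (hS : IsConn P S) (hθ : IsHighestRoot P S θ)
      (hK : IsCascade {i ∈ S | P.pairing i θ = 0} K) : IsCascade S K
  | component {S C K : Set ι} (hC : IsComponent P S C) (hK : IsCascade C K) : IsCascade S K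

/-- The set `𝒦(S)` of subsets of `S`. -/
def cascade (S : Set ι) : Set (Set ι) :=
  {K | IsCascade P S K}

/-- The family `(ε_K)_{K ∈ 𝒦(S)} ∪ (ε_L)_{L ∈ 𝒦(T)}`, indexed by the disjoint union of `𝒦(S)`
and `𝒦(T)`. -/
def cascadeFamily (S T : Set ι) : cascade P S ⊕ cascade P T → M :=
  Sum.elim (fun K => highestRoot P K) (fun L => highestRoot P L)

/-! Helper facts on nonnegative combinations of simple roots. -/

variable {P}

theorem exists_coeff {S : Set ι} {B : Finset ι} (hS : S ⊆ B) {x : M}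
    (hx : x ∈ AddSubmonoid.closure (P.root '' S)) :
    ∃ c : ι → ℕ, (∀ i, i ∉ S → c i = 0) ∧ x = ∑ i ∈ B, c i • P.root i := by
  classical
  induction hx using AddSubmonoid.closure_induction with
  | mem x hx =>
    obtain ⟨j, hj, rfl⟩ := hx
    refine ⟨fun i => if i = j then 1 else 0, fun i hi => ?_, ?_⟩
    · have : i ≠ j := fun h => hi (h ▸ hj)
      simp [this]
    · have hjB : j ∈ B := hS hj
      simp [ite_smul, hjB]
  | zero => exact ⟨0, by simp, by simp⟩
  | add x y _ _ hx hy =>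
    obtain ⟨c, hc, rfl⟩ := hx
    obtain ⟨d, hd, rfl⟩ := hy
    refine ⟨c + d, fun i hi => by simp [hc i hi, hd i hi], ?_⟩
    simp [add_smul, Finset.sum_add_distrib]

/-- If `u + y ∈ ℕS` with `u`, `y` nonnegative combinations of simple roots, then `u ∈ ℕS`. -/
theorem mem_closure_of_add_mem [CharZero R] (b : P.Base) {S : Set ι}
    (hS : S ⊆ (b.support : Set ι)) {u y : M}
    (hu : u ∈ AddSubmonoid.closure (P.root '' b.support))
    (hy : y ∈ AddSubmonoid.closure (P.root '' b.support))
    (h : u + y ∈ AddSubmonoid.closure (P.root '' S)) :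
    u ∈ AddSubmonoid.closure (P.root '' S) := by
  obtain ⟨c, -, hc⟩ := exists_coeff (le_refl _) hu
  obtain ⟨d, -, hd⟩ := exists_coeff (le_refl _) hy
  obtain ⟨e, he, he'⟩ := exists_coeff hS h
  have key : ∀ i ∈ b.support, ((c i + d i : ℕ) : R) - (e i : R) = 0 := by
    refine linearIndepOn_finset_iff.mp b.linearIndepOn_root
      (fun i => ((c i + d i : ℕ) : R) - (e i : R)) ?_
    have : ∑ i ∈ b.support, (c i + d i) • P.root i = ∑ i ∈ b.support, e i • P.root i := by
      rw [← he', hc, hd, ← Finset.sum_add_distrib]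
      simp [add_smul]
    simp only [sub_smul, Nat.cast_smul_eq_nsmul, Finset.sum_sub_distrib, this, sub_self]
  rw [hc]
  refine AddSubmonoid.sum_mem _ fun i hi => ?_
  by_cases hiS : i ∈ S
  · exact AddSubmonoid.nsmul_mem _ (AddSubmonoid.subset_closure (Set.mem_image_of_mem P.root hiS)) _
  · have h1 := key i hi
    rw [he i hiS, Nat.cast_zero, sub_zero, Nat.cast_eq_zero] at h1
    have : c i = 0 := by omega
    simp [this]

/-- The greatest root is unique, so that `highestRoot` does not depend on a choice. -/
theorem IsHighestRoot.highestRoot_eq [CharZero R] (b : P.Base) {S : Set ι}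
    (hS : S ⊆ (b.support : Set ι)) {θ : ι} (h : IsHighestRoot P S θ) :
    highestRoot P S = P.root θ := by
  have hex : ∃ θ, IsHighestRoot P S θ := ⟨θ, h⟩
  rw [highestRoot, dif_pos hex]
  have h' := hex.choose_spec
  set η := hex.choose
  have h1 := h.2 η h'.1
  have h2 := h'.2 θ h.1
  have mem : P.root η - P.root θ ∈ AddSubmonoid.closure (P.root '' (∅ : Set ι)) := by
    have mS := AddSubmonoid.closure_mono (Set.image_mono (f := P.root) hS)
    exact mem_closure_of_add_mem b (Set.empty_subset _) (mS h2) (mS h1) (by simp)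
  simpa [sub_eq_zero] using mem

/-- `R_+^S ∪ R_-^T` is a closed set of roots. -/
theorem posRootsOf_union_negRootsOf_closed [CharZero R] (b : P.Base) {S T : Set ι}
    (hS : S ⊆ (b.support : Set ι)) (hT : T ⊆ (b.support : Set ι)) {i j k : ι}
    (hi : i ∈ posRootsOf P S ∪ negRootsOf P T) (hj : j ∈ posRootsOf P S ∪ negRootsOf P T)
    (hk : P.root k = P.root i + P.root j) : k ∈ posRootsOf P S ∪ negRootsOf P T := by
  have mS := AddSubmonoid.closure_mono (Set.image_mono (f := P.root) hS)
  have mT := AddSubmonoid.closure_mono (Set.image_mono (f := P.root) hT)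
  have mixed : ∀ i j : ι, i ∈ posRootsOf P S → j ∈ negRootsOf P T →
      P.root k = P.root i + P.root j → k ∈ posRootsOf P S ∪ negRootsOf P T := by
    intro i j hi hj hk
    rcases b.root_mem_or_neg_mem k with h | h
    · left
      refine mem_closure_of_add_mem b hS h (mT hj) ?_
      rw [hk, add_neg_cancel_right]
      exact hi
    · right
      refine mem_closure_of_add_mem b hT h (mS hi) ?_
      have : -P.root k + P.root i = -P.root j := by rw [hk]; abel
      rw [this]
      exact hj
  rcases hi with hi | hi <;> rcases hj with hj | hj
  · left
    change P.root k ∈ AddSubmonoid.closure (P.root '' S)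
    rw [hk]
    exact add_mem hi hj
  · exact mixed i j hi hj hk
  · exact mixed j i hj hi (by rw [hk, add_comm])
  · right
    change -P.root k ∈ AddSubmonoid.closure (P.root '' T)
    rw [hk, neg_add]
    exact add_mem hi hj

end Roots

/-! ### The Lie algebra `𝔤_{S,T}` -/

section Subalgebra

variable {K L : Type*} [Field K] [CharZero K] [LieRing L] [LieAlgebra K L] [FiniteDimensional K L]
  [IsKilling K L] {H : LieSubalgebra K L} [H.IsCartanSubalgebra]
  [LieModule.IsTriangularizable K H L]

/-- The subspace `𝔤^A = ∑_{α ∈ A} 𝔤^α`, for a set `A` of roots. -/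
def rootSpaces (A : Set H.root) : Submodule K L :=
  ⨆ α ∈ A, (rootSpace H (α : LieModule.Weight K H L)).toSubmodule

/-- The subspace `𝔥 ⊕ 𝔤^{R_+^S} ⊕ 𝔤^{R_-^T}`. -/
def seaweedSubmodule (S T : Set H.root) : Submodule K L :=
  H.toSubmodule ⊔ rootSpaces (posRootsOf (rootSystem H) S) ⊔
    rootSpaces (negRootsOf (rootSystem H) T)

theorem lie_mem_seaweedSubmodule (b : (rootSystem H).Base) {S T : Set H.root}
    (hS : S ⊆ (b.support : Set H.root)) (hT : T ⊆ (b.support : Set H.root)) {x y : L}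
    (hx : x ∈ seaweedSubmodule S T) (hy : y ∈ seaweedSubmodule S T) :
    ⁅x, y⁆ ∈ seaweedSubmodule S T := by
  set A := posRootsOf (rootSystem H) S ∪ negRootsOf (rootSystem H) T with hA
  -- the weights that occur: `0` and the elements of `A`
  set W : Set (H → K) := insert 0 ((fun α : H.root => ((α : LieModule.Weight K H L) : H → K)) '' A)
    with hW
  have h0 : (rootSpace H (0 : H → K)).toSubmodule = H.toSubmodule := by
    rw [rootSpace_zero_eq]; rfl
  have hsub : seaweedSubmodule S T = ⨆ χ ∈ W, (rootSpace H χ).toSubmodule := by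
    rw [hW, iSup_insert, iSup_image, h0, hA, iSup_union, seaweedSubmodule, sup_assoc]
    rfl
  have hle : ∀ χ ∈ W, (rootSpace H χ).toSubmodule ≤ seaweedSubmodule S T := fun χ hχ =>
    hsub ▸ le_iSup₂ (f := fun χ (_ : χ ∈ W) => (rootSpace H χ).toSubmodule) χ hχ
  have key : ∀ χ₁ ∈ W, ∀ χ₂ ∈ W, ∀ x ∈ rootSpace H χ₁, ∀ y ∈ rootSpace H χ₂,
      ⁅x, y⁆ ∈ seaweedSubmodule S T := by
    intro χ₁ h₁ χ₂ h₂ x hx y hy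
    have hxy : ⁅x, y⁆ ∈ rootSpace H (χ₁ + χ₂) := lie_mem_genWeightSpace_of_mem_genWeightSpace hx hy
    by_cases hbot : rootSpace H (χ₁ + χ₂) = ⊥
    · rw [hbot, LieSubmodule.mem_bot] at hxy
      rw [hxy]; exact zero_mem _
    refine hle (χ₁ + χ₂) ?_ hxy
    by_cases hz : χ₁ + χ₂ = 0
    · exact hz ▸ Set.mem_insert _ _
    rcases h₁ with rfl | ⟨α, hα, rfl⟩
    · simpa using h₂
    rcases h₂ with rfl | ⟨β, hβ, rfl⟩
    · rw [add_zero]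
      exact Set.mem_insert_of_mem _ (Set.mem_image_of_mem _ hα)
    let γ : LieModule.Weight K H L := ⟨_, hbot⟩
    have hγ : γ ∈ H.root := by
      rw [LieSubalgebra.root, Finset.mem_filter_univ]
      exact fun h => hz h
    refine Set.mem_insert_of_mem _ ⟨⟨γ, hγ⟩, ?_, rfl⟩
    refine posRootsOf_union_negRootsOf_closed b hS hT hα hβ ?_
    ext h
    rfl
  rw [hsub] at hx hy
  induction hx using Submodule.iSup_induction' with
  | zero => rw [zero_lie]; exact zero_mem _
  | add x x' _ _ hx hx' => rw [add_lie]; exact add_mem hx hx'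
  | mem χ₁ x hx =>
    by_cases h₁ : χ₁ ∈ W
    swap
    · rw [iSup_neg h₁, Submodule.mem_bot] at hx
      rw [hx, zero_lie]; exact zero_mem _
    rw [iSup_pos h₁] at hx
    induction hy using Submodule.iSup_induction' with
    | zero => rw [lie_zero]; exact zero_mem _
    | add y y' _ _ hy hy' => rw [lie_add]; exact add_mem hy hy'
    | mem χ₂ y hy =>
      by_cases h₂ : χ₂ ∈ W
      swap
      · rw [iSup_neg h₂, Submodule.mem_bot] at hy
        rw [hy, lie_zero]; exact zero_mem _
      rw [iSup_pos h₂] at hy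
      exact key χ₁ h₁ χ₂ h₂ x hx y hy

/-- The Lie subalgebra `𝔤_{S,T} = 𝔥 ⊕ 𝔤^{R_+^S} ⊕ 𝔤^{R_-^T}`, for subsets `S`, `T` of a base. -/
def seaweed (b : (rootSystem H).Base) (S T : Set H.root)
    (hS : S ⊆ (b.support : Set H.root)) (hT : T ⊆ (b.support : Set H.root)) :
    LieSubalgebra K L :=
  { seaweedSubmodule S T with
    lie_mem' := fun hx hy => lie_mem_seaweedSubmodule b hS hT hx hy }

end Subalgebra

end Seaweed

end

/-! Write `ρ e` for the roots `ε_K`, `K ∈ 𝒦(S)`, and `-ε_L`, `L ∈ 𝒦(T)`; up to sign they are the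
given basis of `𝔥^*`. The form is sought as `f = ∑ c_e F_e`, with `F_e` supported on the root space
of `ρ e`, so that the matrix of `f([X, Y])` in a basis of `𝔥` completed by root vectors `x_α` is
invertible for some `c`.

The obstacle is the mixed terms, where `α ∈ R_+^S`, `β ∈ R_-^T` and `α + β = ρ e`. A degeneration
removes them: give `𝔥` degree 0 and `x_α` degree `|ht α|`, scale each basis vector by `s` to its
degree and `F_e` by `s` to the power `-|ht (ρ e)|`. Since `|ht|` is subadditive, the matrix is
polynomial in `s`. At `s = 0` it keeps, among pairs of roots, only those on which `|ht|` is
additive, and these have the same sign (`same_sign_of_natAbs_height_add`). If it is invertible at 0,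
it is invertible for some `s ≠ 0` (`exists_det_ne_zero`).

The matrix at 0 is read off Kostant's cascade. A root `α` of `R_+^S` lies in exactly one `R_+^K`
without being orthogonal to `ε_K`; either `α = ε_K`, or `ε_K - α` is again in `R_+^K`. The same
holds for `T` with signs reversed. Thus the roots outside the family `ρ` are matched in pairs, each
giving rows with a single nonzero entry. What remains pairs `𝔥` with the `x_{ρ e}` through the
values of `ρ e` on `𝔥`, and is invertible because the `ρ e` form a basis
(`mulVec_injective_of_torus`). -/

noncomputable section

namespace Seaweed

open Module LieAlgebra LieAlgebra.IsKilling

/-! ### Positive roots and their pairings with the highest root -/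

section Combinatorics

variable {ι R M N : Type*} [Finite ι] [CommRing R] [CharZero R] [IsDomain R] [AddCommGroup M]
  [Module R M] [AddCommGroup N] [Module R N] {P : RootPairing ι R M N}

omit [Finite ι] [CharZero R] [IsDomain R] in
theorem posRootsOf_mono {S T : Set ι} (h : S ⊆ T) : posRootsOf P S ⊆ posRootsOf P T :=
  fun _ hi => AddSubmonoid.closure_mono (Set.image_mono h) hi

omit [Finite ι] [CharZero R] [IsDomain R] in
theorem posRootsOf_subset_rootsOf (S : Set ι) : posRootsOf P S ⊆ rootsOf P S :=
  fun _ hi => AddSubgroup.le_closure_toAddSubmonoid _ hi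

omit [Finite ι] [CharZero R] [IsDomain R] in
theorem subset_posRootsOf (S : Set ι) : S ⊆ posRootsOf P S :=
  fun _ hi => AddSubmonoid.subset_closure (Set.mem_image_of_mem _ hi)

omit [Finite ι] [IsDomain R] in
theorem eq_zero_of_mem_closure_of_neg_mem (b : P.Base) {x : M}
    (h : x ∈ AddSubmonoid.closure (P.root '' b.support))
    (h' : -x ∈ AddSubmonoid.closure (P.root '' b.support)) : x = 0 := by
  have := mem_closure_of_add_mem b (S := ∅) (Set.empty_subset _) h h' (by simp)
  simpa using this

omit [Finite ι] [IsDomain R] in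
theorem not_neg_mem_closure (b : P.Base) {S : Set ι} (hS : S ⊆ (b.support : Set ι)) {i : ι}
    (h : i ∈ posRootsOf P S) : -P.root i ∉ AddSubmonoid.closure (P.root '' S) := fun h' =>
  P.ne_zero i <| eq_zero_of_mem_closure_of_neg_mem b (posRootsOf_mono hS h)
    (AddSubmonoid.closure_mono (Set.image_mono hS) h')

omit [Finite ι] [CharZero R] [IsDomain R] in
theorem exists_coeff_pairing {S : Set ι} {B : Finset ι} (hS : S ⊆ B) {i : ι}
    (hi : i ∈ posRootsOf P S) :
    ∃ c : ι → ℕ, (∀ k, k ∉ S → c k = 0) ∧ P.root i = ∑ k ∈ B, c k • P.root k ∧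
      ∀ j, P.pairing i j = ∑ k ∈ B, (c k : R) * P.pairing k j := by
  obtain ⟨c, hc, h⟩ := exists_coeff hS hi
  refine ⟨c, hc, h, fun j => ?_⟩
  rw [← P.root_coroot'_eq_pairing, h, map_sum]
  simp

section Crystallographic

variable [P.IsCrystallographic]

omit [Finite ι] [IsDomain R] in
theorem exists_coeff_pairingIn {S : Set ι} {B : Finset ι} (hS : S ⊆ B) {i : ι}
    (hi : i ∈ posRootsOf P S) :
    ∃ c : ι → ℕ, (∀ k, k ∉ S → c k = 0) ∧ P.root i = ∑ k ∈ B, c k • P.root k ∧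
      ∀ j, P.pairingIn ℤ i j = ∑ k ∈ B, (c k : ℤ) * P.pairingIn ℤ k j := by
  obtain ⟨c, hc, h, h'⟩ := exists_coeff_pairing hS hi
  refine ⟨c, hc, h, fun j => FaithfulSMul.algebraMap_injective ℤ R ?_⟩
  simpa only [map_sum, map_mul, map_natCast, P.algebraMap_pairingIn] using h' j

omit [Finite ι] [IsDomain R] in
-- A vanishing sum of nonnegative terms has only zero terms, so every simple root occurring in `i`
-- is orthogonal to `j`. This is the descent step of the cascade.
theorem mem_posRootsOf_orthogonal {S : Set ι} {B : Finset ι} (hS : S ⊆ B) {i j : ι}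
    (hj : ∀ k ∈ S, 0 ≤ P.pairingIn ℤ k j) (hi : i ∈ posRootsOf P S)
    (hij : P.pairingIn ℤ i j = 0) : i ∈ posRootsOf P {k ∈ S | P.pairing k j = 0} := by
  obtain ⟨c, hc, hi', h⟩ := exists_coeff_pairingIn hS hi
  have hnn : ∀ k ∈ B, 0 ≤ (c k : ℤ) * P.pairingIn ℤ k j := fun k _ => by
    by_cases hk : k ∈ S
    · exact mul_nonneg (by positivity) (hj k hk)
    · simp [hc k hk]
  rw [h, Finset.sum_eq_zero_iff_of_nonneg hnn] at hij
  change P.root i ∈ AddSubmonoid.closure _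
  rw [hi']
  refine AddSubmonoid.sum_mem _ fun k hk => ?_
  by_cases hck : c k = 0
  · simp [hck]
  suffices hmem : k ∈ {k ∈ S | P.pairing k j = 0} from
    AddSubmonoid.nsmul_mem _ (AddSubmonoid.subset_closure (Set.mem_image_of_mem _ hmem)) _
  refine ⟨?_, ?_⟩
  · by_contra hkS
    exact hck (hc k hkS)
  · have := hij k hk
    rw [mul_eq_zero, Nat.cast_eq_zero, or_iff_right hck] at this
    rw [← P.algebraMap_pairingIn ℤ, this, map_zero]

omit [Finite ι] [CharZero R] [IsDomain R] [P.IsCrystallographic] in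
theorem pairing_eq_zero_of_mem_posRootsOf {S : Set ι} {B : Finset ι} (hS : S ⊆ B) {i j : ι}
    (hj : ∀ k ∈ S, P.pairing k j = 0) (hi : i ∈ posRootsOf P S) : P.pairing i j = 0 := by
  obtain ⟨c, hc, -, h⟩ := exists_coeff_pairing hS hi
  rw [h]
  refine Finset.sum_eq_zero fun k _ => ?_
  by_cases hk : k ∈ S
  · simp [hj k hk]
  · simp [hc k hk]

omit [Finite ι] [CharZero R] [IsDomain R] [P.IsCrystallographic] in
theorem IsHighestRoot.mem_posRootsOf {S : Set ι} (hS : S.Nonempty) {θ : ι}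
    (h : IsHighestRoot P S θ) : θ ∈ posRootsOf P S := by
  obtain ⟨i, hi⟩ := hS
  have hi' : i ∈ posRootsOf P S := subset_posRootsOf S hi
  have := add_mem (h.2 i (posRootsOf_subset_rootsOf S hi')) hi'
  rwa [sub_add_cancel] at this

omit [Finite ι] [IsDomain R] [P.IsCrystallographic] in
theorem IsHighestRoot.root_add_root_notMem (b : P.Base) {S : Set ι}
    (hS : S ⊆ (b.support : Set ι)) {θ i : ι} (h : IsHighestRoot P S θ) (hi : i ∈ posRootsOf P S) :
    P.root θ + P.root i ∉ Set.range P.root := by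
  rintro ⟨k, hk⟩
  have hk' : k ∈ rootsOf P S := by
    change P.root k ∈ AddSubgroup.closure _
    rw [hk]
    exact add_mem h.1 (posRootsOf_subset_rootsOf S hi)
  have := h.2 k hk'
  rw [hk, sub_add_cancel_left] at this
  exact not_neg_mem_closure b hS hi this

/-- Otherwise `θ + i` would be a root, above the highest one. -/
theorem IsHighestRoot.pairingIn_nonneg (b : P.Base) {S : Set ι}
    (hS : S ⊆ (b.support : Set ι)) {θ : ι} (h : IsHighestRoot P S θ) {i : ι}
    (hi : i ∈ posRootsOf P S) (hne : S.Nonempty) : 0 ≤ P.pairingIn ℤ i θ := by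
  by_contra! hlt
  refine h.root_add_root_notMem b hS hi ?_
  rw [add_comm]
  refine P.root_add_root_mem_of_pairingIn_neg hlt fun heq => ?_
  refine not_neg_mem_closure b hS (h.mem_posRootsOf hne) ?_
  rw [← heq]
  exact hi

/-- If `i` were orthogonal to `θ = i + j`, then `⟨j, i^∨⟩ = -2`, and reflecting `j` in `i` would
give the root `j + 2i = θ + i`, above `θ`. -/
theorem IsHighestRoot.pairingIn_pos_of_add_eq (b : P.Base) {S : Set ι}
    (hS : S ⊆ (b.support : Set ι)) {θ : ι} (h : IsHighestRoot P S θ) (hne : S.Nonempty)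
    {i j : ι} (hi : i ∈ posRootsOf P S) (hij : P.root i + P.root j = P.root θ) :
    0 < P.pairingIn ℤ i θ := by
  refine lt_of_le_of_ne (h.pairingIn_nonneg b hS hi hne) fun h0 => ?_
  have h0' : P.pairing i θ = 0 := by rw [← P.algebraMap_pairingIn ℤ, ← h0, map_zero]
  rw [P.pairing_eq_zero_iff'] at h0'
  have hadd := P.pairing_eq_add_of_root_eq_add (l := i) hij.symm
  rw [h0', P.pairing_same] at hadd
  have hji : P.pairing j i = -2 := by linear_combination -hadd
  refine h.root_add_root_notMem b hS hi ⟨P.reflectionPerm i j, ?_⟩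
  rw [P.root_reflectionPerm, P.reflection_apply_root, hji, ← hij]
  module

theorem IsHighestRoot.exists_add_eq {S : Set ι} {θ : ι} (h : IsHighestRoot P S θ) {i : ι}
    (hi : i ∈ posRootsOf P S) (hpos : 0 < P.pairingIn ℤ i θ) (hne : i ≠ θ) :
    ∃ j ∈ posRootsOf P S, P.root i + P.root j = P.root θ := by
  rw [P.zero_lt_pairingIn_iff'] at hpos
  obtain ⟨j, hj⟩ := P.root_sub_root_mem_of_pairingIn_pos hpos hne.symm
  refine ⟨j, ?_, by rw [hj]; abel⟩
  change P.root j ∈ AddSubmonoid.closure _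
  rw [hj]
  exact h.2 i (posRootsOf_subset_rootsOf S hi)

omit [Finite ι] [IsDomain R] [P.IsCrystallographic] in
theorem IsHighestRoot.unique (b : P.Base) {S : Set ι} (hS : S ⊆ (b.support : Set ι)) {θ η : ι}
    (h : IsHighestRoot P S θ) (h' : IsHighestRoot P S η) : θ = η :=
  P.root.injective <| (h.highestRoot_eq b hS).symm.trans (h'.highestRoot_eq b hS)

/-! ### Supports of positive roots are connected -/

omit [Finite ι] [IsDomain R] [P.IsCrystallographic] in
theorem mem_of_mem_posRootsOf_of_mem_support (b : P.Base) {S : Set ι}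
    (hS : S ⊆ (b.support : Set ι)) {i : ι} (hi : i ∈ b.support) (hiS : i ∈ posRootsOf P S) :
    i ∈ S := by
  classical
  obtain ⟨c, hc, h⟩ := exists_coeff hS hiS
  by_contra hni
  have hz := linearIndepOn_finset_iff.mp b.linearIndepOn_root
    (fun k => (c k : R) - if k = i then 1 else 0) (by
      simp [sub_smul, Finset.sum_sub_distrib, ite_smul, hi, Nat.cast_smul_eq_nsmul, ← h]) i hi
  simp [hc i hni] at hz

omit [Finite ι] [IsDomain R] [P.IsCrystallographic] in
theorem isPos_of_mem_posRootsOf (b : P.Base) {S : Set ι} (hS : S ⊆ (b.support : Set ι)) {i : ι}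
    (hi : i ∈ posRootsOf P S) : b.IsPos i := by
  obtain ⟨c, -, h⟩ := exists_coeff hS hi
  rw [RootPairing.Base.isPos_iff']
  rw [RootPairing.Base.height_eq_sum (f := fun k => (c k : ℤ)) (by simpa using h)]
  exact Finset.sum_nonneg fun _ _ => by positivity

omit [Finite ι] [CharZero R] [IsDomain R] [P.IsCrystallographic] in
theorem isConn_singleton (i : ι) : IsConn P {i} := by
  have : Subsingleton ({i} : Set ι) := ⟨fun a b => Subtype.ext (a.2.trans b.2.symm)⟩
  have : Nonempty ({i} : Set ι) := ⟨⟨i, rfl⟩⟩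
  exact ⟨.of_subsingleton⟩

omit [Finite ι] [CharZero R] [IsDomain R] [P.IsCrystallographic] in
theorem IsConn.nonempty {S : Set ι} (h : IsConn P S) : S.Nonempty :=
  Set.nonempty_coe_sort.mp (SimpleGraph.Connected.nonempty h)

/-- `D` is the support of the root, built by adding simple roots one at a time. If the new simple
root `j` were joined to nothing in `D`, reflecting `i + j` in `j` would give the root `i - j`, with
coefficients of both signs. -/
theorem exists_isConn_of_isPos (b : P.Base) {i : ι} (hi : b.IsPos i) :
    ∃ D : Set ι, D ⊆ (b.support : Set ι) ∧ IsConn P D ∧ i ∈ posRootsOf P D ∧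
      ∀ S ⊆ (b.support : Set ι), i ∈ posRootsOf P S → D ⊆ S := by
  refine hi.induction_on_add (p := fun i => ∃ D : Set ι, D ⊆ (b.support : Set ι) ∧ IsConn P D ∧
      i ∈ posRootsOf P D ∧ ∀ S ⊆ (b.support : Set ι), i ∈ posRootsOf P S → D ⊆ S) ?_ ?_
  · intro i hi
    refine ⟨{i}, by simpa using hi, isConn_singleton i, subset_posRootsOf _ rfl, fun S hS hiS => ?_⟩
    simpa using mem_of_mem_posRootsOf_of_mem_support b hS hi hiS
  · rintro i j k hk ⟨D, hDb, hD, hiD, hmin⟩ hj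
    have hjpos : j ∈ posRootsOf P (b.support : Set ι) := subset_posRootsOf _ hj
    have hmin' : ∀ S ⊆ (b.support : Set ι), k ∈ posRootsOf P S → D ∪ {j} ⊆ S := by
      intro S hS hkS
      refine Set.union_subset (hmin S hS ?_) (Set.singleton_subset_iff.mpr ?_)
      · refine mem_closure_of_add_mem b hS (posRootsOf_mono hDb hiD) hjpos ?_
        rw [← hk]
        exact hkS
      · refine mem_of_mem_posRootsOf_of_mem_support b hS hj ?_
        refine mem_closure_of_add_mem b hS hjpos (posRootsOf_mono hDb hiD) ?_
        rw [add_comm, ← hk]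
        exact hkS
    refine ⟨D ∪ {j}, Set.union_subset hDb (by simpa using hj), ?_, ?_, hmin'⟩
    · by_cases hjD : j ∈ D
      · rwa [Set.union_singleton, Set.insert_eq_of_mem hjD]
      by_cases hadj : ∃ d ∈ D, (dynkinGraph P).Adj d j
      · obtain ⟨d, hd, hadj⟩ := hadj
        exact SimpleGraph.connected_induce_union hD.preconnected
          (isConn_singleton (P := P) j).preconnected hd (Set.mem_singleton j) hadj
      exfalso
      push Not at hadj
      have hort : ∀ d ∈ D, P.pairing d j = 0 := fun d hd => by
        by_contra hne
        exact hadj d hd ⟨fun h => hjD (h ▸ hd), Or.inl hne⟩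
      have hij : P.pairing i j = 0 := pairing_eq_zero_of_mem_posRootsOf hDb hort hiD
      let := P.indexNeg
      have hl : P.root (P.reflectionPerm j k) = P.root i - P.root j := by
        have := P.pairing_eq_add_of_root_eq_add (l := j) hk
        rw [hij, P.pairing_same, zero_add] at this
        rw [P.root_reflectionPerm, P.reflection_apply_root, this, hk]
        module
      rcases b.root_mem_or_neg_mem (P.reflectionPerm j k) with h | h
      · refine hjD (mem_of_mem_posRootsOf_of_mem_support b hDb hj ?_)
        refine mem_closure_of_add_mem b hDb hjpos h ?_
        rw [hl, add_sub_cancel]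
        exact hiD
      · have hi' : P.root i ∈ AddSubmonoid.closure (P.root '' {j}) := by
          refine mem_closure_of_add_mem b (by simpa using hj) (posRootsOf_mono hDb hiD) h ?_
          rw [hl, neg_sub, add_sub_cancel]
          exact subset_posRootsOf {j} rfl
        have := hmin {j} (by simpa using hj) hi'
        obtain ⟨d, hd⟩ := hD.nonempty
        exact hjD (by rw [← show d = j from this hd]; exact hd)
    · change P.root k ∈ AddSubmonoid.closure _
      rw [hk]
      exact add_mem (posRootsOf_mono Set.subset_union_left hiD)
        (subset_posRootsOf _ (Set.mem_union_right _ rfl))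

omit [CharZero R] [IsDomain R] [P.IsCrystallographic] in
theorem exists_isComponent_of_isConn {S D : Set ι} (hDS : D ⊆ S) (hD : IsConn P D) :
    ∃ C, IsComponent P S C ∧ D ⊆ C := by
  obtain ⟨C, hC, hmax⟩ := (Set.toFinite {D : Set ι | D ⊆ S ∧ IsConn P D}).exists_le_maximal
    (show D ∈ {D : Set ι | D ⊆ S ∧ IsConn P D} from ⟨hDS, hD⟩)
  exact ⟨C, hmax, hC⟩

theorem exists_isComponent_of_mem_posRootsOf (b : P.Base) {S : Set ι}
    (hS : S ⊆ (b.support : Set ι)) {i : ι} (hi : i ∈ posRootsOf P S) :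
    ∃ C, IsComponent P S C ∧ i ∈ posRootsOf P C := by
  obtain ⟨D, -, hD, hiD, hmin⟩ := exists_isConn_of_isPos b (isPos_of_mem_posRootsOf b hS hi)
  obtain ⟨C, hC, hDC⟩ := exists_isComponent_of_isConn (hmin S hS hi) hD
  exact ⟨C, hC, posRootsOf_mono hDC hiD⟩

omit [Finite ι] [CharZero R] [IsDomain R] [P.IsCrystallographic] in
theorem IsComponent.eq_or_disjoint {S C D : Set ι} (hC : IsComponent P S C)
    (hD : IsComponent P S D) : C = D ∨ Disjoint C D := by
  by_cases h : (C ∩ D).Nonempty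
  · left
    have hU : C ∪ D ⊆ S ∧ IsConn P (C ∪ D) := ⟨Set.union_subset hC.1.1 hD.1.1,
      SimpleGraph.induce_union_connected hC.1.2.preconnected hD.1.2.preconnected h⟩
    exact (hC.eq_of_le hU Set.subset_union_left).trans
      (hD.eq_of_le hU Set.subset_union_right).symm
  · right
    rwa [Set.not_nonempty_iff_eq_empty, ← Set.disjoint_iff_inter_eq_empty] at h

omit [Finite ι] [CharZero R] [IsDomain R] [P.IsCrystallographic] in
theorem IsConn.isComponent_self {S : Set ι} (h : IsConn P S) : IsComponent P S S :=
  ⟨⟨le_refl _, h⟩, fun _ hD _ => hD.1⟩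

/-! ### The cascade -/

omit [Finite ι] [CharZero R] [IsDomain R] [P.IsCrystallographic] in
theorem IsCascade.exists_isComponent {S K : Set ι} (h : IsCascade P S K) :
    ∃ C, IsComponent P S C ∧ (K = C ∨ ∃ θ, IsHighestRoot P C θ ∧
      IsCascade P {i ∈ C | P.pairing i θ = 0} K) := by
  induction h with
  | self hS => exact ⟨_, hS.isComponent_self, Or.inl rfl⟩
  | orthogonal hS hθ hK _ => exact ⟨_, hS.isComponent_self, Or.inr ⟨_, hθ, hK⟩⟩
  | component hC _ ih =>
    obtain ⟨D, hD, hK⟩ := ih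
    obtain rfl : D = _ := hD.eq_of_le ⟨le_refl _, hC.1.2⟩ hD.1.1
    exact ⟨D, hC, hK⟩

omit [Finite ι] [CharZero R] [IsDomain R] [P.IsCrystallographic] in
theorem IsCascade.subset {S K : Set ι} (h : IsCascade P S K) : K ⊆ S := by
  induction h with
  | self _ => exact le_refl _
  | orthogonal _ _ _ ih => exact ih.trans (Set.sep_subset _ _)
  | component hC _ ih => exact ih.trans hC.1.1

omit [Finite ι] [CharZero R] [IsDomain R] [P.IsCrystallographic] in
theorem IsCascade.isConn {S K : Set ι} (h : IsCascade P S K) : IsConn P K := by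
  induction h with
  | self hS => exact hS
  | orthogonal _ _ _ ih => exact ih
  | component _ _ ih => exact ih

omit [Finite ι] [IsDomain R] [P.IsCrystallographic] in
theorem IsHighestRoot.sep_ssubset (b : P.Base) {S C : Set ι} (hS : S ⊆ (b.support : Set ι))
    (hC : IsComponent P S C) {θ : ι} (h : IsHighestRoot P C θ) :
    {i ∈ C | P.pairing i θ = 0} ⊂ S := by
  refine lt_of_lt_of_le (?_ : _ < C) hC.1.1
  refine (Set.sep_subset C _).ssubset_of_ne fun heq => ?_
  have hall : ∀ i ∈ C, P.pairing i θ = 0 := Set.sep_eq_self_iff_mem_true.mp heq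
  have := pairing_eq_zero_of_mem_posRootsOf (hC.1.1.trans hS) hall
    (h.mem_posRootsOf hC.1.2.nonempty)
  simp at this

omit [IsDomain R] [P.IsCrystallographic] in
-- Follow both members down the recursion until they part. Either they enter different components,
-- or one of them is the whole component and the other lies in the orthogonal of its highest root.
theorem IsCascade.laminar (b : P.Base) {S : Set ι} (hS : S ⊆ (b.support : Set ι)) {K K' : Set ι}
    (hK : IsCascade P S K) (hK' : IsCascade P S K') :
    K = K' ∨ Disjoint K K' ∨
      (∀ θ, IsHighestRoot P K θ → ∀ i ∈ K', P.pairing i θ = 0) ∨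
      (∀ θ, IsHighestRoot P K' θ → ∀ i ∈ K, P.pairing i θ = 0) := by
  induction S using WellFoundedLT.induction with
  | ind S ih =>
  obtain ⟨C, hC, h⟩ := hK.exists_isComponent
  obtain ⟨C', hC', h'⟩ := hK'.exists_isComponent
  have hKC : K ⊆ C := by
    rcases h with rfl | ⟨θ, -, h⟩
    exacts [le_refl _, h.subset.trans (Set.sep_subset _ _)]
  have hKC' : K' ⊆ C' := by
    rcases h' with rfl | ⟨θ, -, h⟩
    exacts [le_refl _, h.subset.trans (Set.sep_subset _ _)]
  rcases hC.eq_or_disjoint hC' with rfl | hdisj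
  swap
  · exact Or.inr (Or.inl (hdisj.mono hKC hKC'))
  have hCb := hC.1.1.trans hS
  rcases h with rfl | ⟨θ, hθ, h⟩ <;> rcases h' with rfl | ⟨θ', hθ', h'⟩
  · exact Or.inl rfl
  · refine Or.inr (Or.inr (Or.inl fun η hη i hi => ?_))
    rw [hη.unique b hCb hθ']
    exact (h'.subset hi).2
  · refine Or.inr (Or.inr (Or.inr fun η hη i hi => ?_))
    rw [hη.unique b hCb hθ]
    exact (h.subset hi).2
  · obtain rfl := hθ.unique b hCb hθ'
    have hlt := hθ.sep_ssubset b hS hC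
    exact ih _ hlt (hlt.subset.trans hS) h h'

/-- In the component containing `i`, the pairing with the highest root is nonnegative. If it is
positive, stop; if it is zero, `i` is supported on the orthogonal simple roots, a strictly smaller
set. -/
theorem exists_isCascade_of_mem_posRootsOf (b : P.Base) {S : Set ι}
    (hS : S ⊆ (b.support : Set ι))
    (hex : ∀ K, IsCascade P S K → ∃ θ, IsHighestRoot P K θ) {i : ι} (hi : i ∈ posRootsOf P S) :
    ∃ K θ, IsCascade P S K ∧ IsHighestRoot P K θ ∧ i ∈ posRootsOf P K ∧
      0 < P.pairingIn ℤ i θ := by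
  induction S using WellFoundedLT.induction with
  | ind S ih =>
  obtain ⟨C, hC, hiC⟩ := exists_isComponent_of_mem_posRootsOf b hS hi
  have hCb := hC.1.1.trans hS
  have hCS : IsCascade P S C := .component hC (.self hC.1.2)
  obtain ⟨θ, hθ⟩ := hex C hCS
  have hnn := hθ.pairingIn_nonneg b hCb hiC hC.1.2.nonempty
  rcases hnn.lt_or_eq with hpos | hzero
  · exact ⟨C, θ, hCS, hθ, hiC, hpos⟩
  · have hlt := hθ.sep_ssubset b hS hC
    have hcasc : ∀ K, IsCascade P {i ∈ C | P.pairing i θ = 0} K → IsCascade P S K :=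
      fun K hK => .component hC (.orthogonal hC.1.2 hθ hK)
    obtain ⟨K, η, hK, h⟩ := ih _ hlt (hlt.subset.trans hS) (fun K hK => hex K (hcasc K hK))
      (mem_posRootsOf_orthogonal hCb (fun k hk => hθ.pairingIn_nonneg b hCb
        (subset_posRootsOf C hk) hC.1.2.nonempty) hiC hzero.symm)
    exact ⟨K, η, hcasc K hK, h⟩

omit [Finite ι] [IsDomain R] [P.IsCrystallographic] in
theorem disjoint_posRootsOf (b : P.Base) {K K' : Set ι} (hK : K ⊆ (b.support : Set ι))
    (hK' : K' ⊆ (b.support : Set ι)) (h : Disjoint K K') :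
    Disjoint (posRootsOf P K) (posRootsOf P K') := by
  classical
  rw [Set.disjoint_left]
  intro i hi hi'
  obtain ⟨c, hc, hci⟩ := exists_coeff hK hi
  obtain ⟨d, hd, hdi⟩ := exists_coeff hK' hi'
  have key := linearIndepOn_finset_iff.mp b.linearIndepOn_root
    (fun k => (c k : R) - (d k : R)) (by
      simp [sub_smul, Finset.sum_sub_distrib, Nat.cast_smul_eq_nsmul, ← hci, ← hdi])
  refine P.ne_zero i ?_
  rw [hci]
  refine Finset.sum_eq_zero fun k hk => ?_
  have hk' := key k hk
  by_cases hkK : k ∈ K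
  · rw [hd k (Set.disjoint_left.mp h hkK), Nat.cast_zero, sub_zero, Nat.cast_eq_zero] at hk'
    simp [hk']
  · simp [hc k hkK]

omit [IsDomain R] in
-- By `laminar`, distinct members either share no root, or all roots of one are orthogonal to the
-- highest root of the other, against positivity.
theorem IsCascade.eq_of_mem (b : P.Base) {S : Set ι} (hS : S ⊆ (b.support : Set ι))
    {K K' : Set ι} {θ θ' : ι} (hK : IsCascade P S K) (hK' : IsCascade P S K')
    (hθ : IsHighestRoot P K θ) (hθ' : IsHighestRoot P K' θ') {i : ι} (hi : i ∈ posRootsOf P K)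
    (hi' : i ∈ posRootsOf P K') (hpos : 0 < P.pairingIn ℤ i θ) (hpos' : 0 < P.pairingIn ℤ i θ') :
    K = K' := by
  have hKb := hK.subset.trans hS
  have hKb' := hK'.subset.trans hS
  rcases hK.laminar b hS hK' with h | h | h | h
  · exact h
  · exact absurd hi' (Set.disjoint_left.mp (disjoint_posRootsOf b hKb hKb' h) hi)
  · have := pairing_eq_zero_of_mem_posRootsOf hKb' (h θ hθ) hi'
    rw [← P.algebraMap_pairingIn ℤ, FaithfulSMul.algebraMap_eq_zero_iff] at this
    omega
  · have := pairing_eq_zero_of_mem_posRootsOf hKb (h θ' hθ') hi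
    rw [← P.algebraMap_pairingIn ℤ, FaithfulSMul.algebraMap_eq_zero_iff] at this
    omega

/-- If `i + j = ε_K` with `i, j ∈ R_+^S`, then `i` lies in `R_+^K` and is not orthogonal to
`ε_K`. -/
theorem IsCascade.mem_and_pos_of_add_eq (b : P.Base) {S : Set ι} (hS : S ⊆ (b.support : Set ι))
    {K : Set ι} {θ : ι} (hK : IsCascade P S K) (hθ : IsHighestRoot P K θ) {i j : ι}
    (hi : i ∈ posRootsOf P S) (hj : j ∈ posRootsOf P S) (hij : P.root i + P.root j = P.root θ) :
    i ∈ posRootsOf P K ∧ 0 < P.pairingIn ℤ i θ := by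
  have hKb := hK.subset.trans hS
  have hiK : i ∈ posRootsOf P K := by
    refine mem_closure_of_add_mem b hKb (posRootsOf_mono hS hi) (posRootsOf_mono hS hj) ?_
    rw [hij]
    exact hθ.mem_posRootsOf hK.isConn.nonempty
  exact ⟨hiK, hθ.pairingIn_pos_of_add_eq b hKb hK.isConn.nonempty hiK hij⟩

theorem IsCascade.eq_of_add_eq_of_add_eq (b : P.Base) {S : Set ι}
    (hS : S ⊆ (b.support : Set ι)) {K K' : Set ι} {θ θ' : ι} (hK : IsCascade P S K)
    (hK' : IsCascade P S K') (hθ : IsHighestRoot P K θ) (hθ' : IsHighestRoot P K' θ')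
    {i j j' : ι} (hi : i ∈ posRootsOf P S) (hj : j ∈ posRootsOf P S) (hj' : j' ∈ posRootsOf P S)
    (hij : P.root i + P.root j = P.root θ) (hij' : P.root i + P.root j' = P.root θ') :
    K = K' := by
  obtain ⟨h1, h2⟩ := hK.mem_and_pos_of_add_eq b hS hθ hi hj hij
  obtain ⟨h3, h4⟩ := hK'.mem_and_pos_of_add_eq b hS hθ' hi hj' hij'
  exact hK.eq_of_mem b hS hK' hθ hθ' h1 h3 h2 h4

/-- Otherwise `ε_K` would lie in `R_+^{K'}` and not be orthogonal to `ε_{K'}`; uniqueness gives `K =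
K'`, hence a zero root `j`. -/
theorem IsCascade.add_ne (b : P.Base) {S : Set ι} (hS : S ⊆ (b.support : Set ι)) {K K' : Set ι}
    {θ θ' : ι} (hK : IsCascade P S K) (hK' : IsCascade P S K') (hθ : IsHighestRoot P K θ)
    (hθ' : IsHighestRoot P K' θ') {j : ι} (hj : j ∈ posRootsOf P S) :
    P.root θ + P.root j ≠ P.root θ' := by
  intro h
  have hθK := hθ.mem_posRootsOf hK.isConn.nonempty
  obtain ⟨h1, h2⟩ := hK'.mem_and_pos_of_add_eq b hS hθ' (posRootsOf_mono hK.subset hθK) hj h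
  obtain rfl := hK.eq_of_mem b hS hK' hθ hθ' hθK h1 (by simp) h2
  rw [hθ.unique b (hK.subset.trans hS) hθ', add_eq_left] at h
  exact P.ne_zero j h

theorem exists_isCascade_eq_or_add_eq (b : P.Base) {S : Set ι} (hS : S ⊆ (b.support : Set ι))
    (hex : ∀ K, IsCascade P S K → ∃ θ, IsHighestRoot P K θ) {i : ι} (hi : i ∈ posRootsOf P S) :
    ∃ K θ, IsCascade P S K ∧ IsHighestRoot P K θ ∧
      (i = θ ∨ 0 < P.pairingIn ℤ i θ ∧ P.root θ + P.root i ∉ Set.range P.root ∧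
        ∃ j ∈ posRootsOf P S, P.root i + P.root j = P.root θ) := by
  obtain ⟨K, θ, hK, hθ, hiK, hpos⟩ := exists_isCascade_of_mem_posRootsOf b hS hex hi
  refine ⟨K, θ, hK, hθ, or_iff_not_imp_left.mpr fun hne => ⟨hpos, ?_, ?_⟩⟩
  · exact hθ.root_add_root_notMem b (hK.subset.trans hS) hiK
  · obtain ⟨j, hj, h⟩ := hθ.exists_add_eq hiK hpos hne
    exact ⟨j, posRootsOf_mono hK.subset hj, h⟩

end Crystallographic

end Combinatorics

/-! ### Degeneration of determinants and invertibility of the limit matrix -/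

section LinearAlgebra

/-- A one-parameter degeneration argument: if the matrix obtained by keeping only the terms of
degree zero is invertible, then some combination of the matrices `g e` is invertible. -/
theorem exists_det_ne_zero {K I E : Type*} [Field K] [Infinite K] [Fintype I] [DecidableEq I]
    [Fintype E] (g : E → Matrix I I K) (n : I → ℕ) (m : E → ℕ)
    (hg : ∀ e i j, g e i j ≠ 0 → m e ≤ n i + n j)
    (h0 : (Matrix.of fun i j => ∑ e, if n i + n j = m e then g e i j else 0).det ≠ 0) :
    ∃ c : E → K, (∑ e, c e • g e).det ≠ 0 := by
  open Polynomial in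
  let N : Matrix I I K[X] := Matrix.of fun i j => ∑ e, C (g e i j) * X ^ (n i + n j - m e)
  have hN : ∀ s : K, N.det.eval s = (N.map (evalRingHom s)).det := fun s => by
    rw [← coe_evalRingHom, RingHom.map_det]
    rfl
  have hN0 : N.det ≠ 0 := by
    intro h
    refine h0 ?_
    suffices heval : (Matrix.of fun i j => ∑ e, if n i + n j = m e then g e i j else 0).det =
        N.det.eval 0 by rw [heval, h, eval_zero]
    rw [hN]
    congr 1
    ext i j
    simp only [N, Matrix.of_apply, Matrix.map_apply, coe_evalRingHom, eval_finsetSum, eval_mul,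
      eval_C, eval_pow, eval_X]
    refine Finset.sum_congr rfl fun e _ => ?_
    by_cases hge : g e i j = 0
    · simp [hge]
    have := hg e i j hge
    by_cases heq : n i + n j = m e
    · simp [heq]
    · rw [if_neg heq, zero_pow (by omega), mul_zero]
  -- The factor `X` forces the chosen `s` to be nonzero.
  obtain ⟨s, hs⟩ : ∃ s : K, (X * N.det).eval s ≠ 0 := by
    by_contra! hall
    exact mul_ne_zero X_ne_zero hN0 (Polynomial.funext (by simpa using hall))
  rw [eval_mul, eval_X, mul_ne_zero_iff, hN] at hs
  obtain ⟨hs0, hs⟩ := hs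
  refine ⟨fun e => (s ^ m e)⁻¹, fun hdet => hs ?_⟩
  have : N.map (evalRingHom s) = Matrix.diagonal (fun i => s ^ n i) *
      (∑ e, (s ^ m e)⁻¹ • g e) * Matrix.diagonal (fun i => s ^ n i) := by
    ext i j
    simp only [N, Matrix.of_apply, Matrix.map_apply, coe_evalRingHom, eval_finsetSum, eval_mul,
      eval_C, eval_pow, eval_X, Matrix.mul_diagonal, Matrix.diagonal_mul, Matrix.sum_apply,
      Matrix.smul_apply, smul_eq_mul, Finset.mul_sum, Finset.sum_mul]
    refine Finset.sum_congr rfl fun e _ => ?_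
    by_cases hge : g e i j = 0
    · simp [hge]
    rw [pow_sub₀ _ hs0 (hg e i j hge), pow_add]
    ring
  rw [this, Matrix.det_mul, Matrix.det_mul, hdet, mul_zero, zero_mul]

/-- Eliminate a kernel vector in three stages: the rows of `h4` kill the coordinates outside `ρ`;
the torus rows and the independence of `wt` kill those on `ρ`; the rows of `ρ` and the spanning
property kill the torus coordinates. Entries of these last rows against root vectors need no
control. -/
theorem mulVec_injective_of_torus {K V κ A E : Type*} [Field K] [AddCommGroup V] [Module K V]
    [Fintype κ] [Fintype A] [Fintype E] (h : Basis κ K V) (ρ : E → A) (wt : E → Dual K V)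
    (hli : LinearIndependent K wt) (hspan : Submodule.span K (Set.range wt) = ⊤)
    (hρ : Function.Injective ρ) (c : E → K) (hc : ∀ e, c e ≠ 0)
    (M : Matrix (κ ⊕ A) (κ ⊕ A) K) (h1 : ∀ k l, M (.inl k) (.inl l) = 0)
    (h2 : ∀ k e, M (.inl k) (.inr (ρ e)) = c e * wt e (h k))
    (h3 : ∀ k e, M (.inr (ρ e)) (.inl k) = -(c e * wt e (h k)))
    (h4 : ∀ α, α ∉ Set.range ρ → ∃ i, M i (.inr α) ≠ 0 ∧ ∀ j, j ≠ .inr α → M i j = 0)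
    (v : κ ⊕ A → K) (hv : M.mulVec v = 0) : v = 0 := by
  have hrow : ∀ i, ∑ k, M i (.inl k) * v (.inl k) + ∑ α, M i (.inr α) * v (.inr α) = 0 := by
    intro i
    rw [← Fintype.sum_sum_type (fun j => M i j * v j)]
    exact congrFun hv i
  have hv1 : ∀ α, α ∉ Set.range ρ → v (.inr α) = 0 := by
    intro α hα
    obtain ⟨i, hi, hi'⟩ := h4 α hα
    have : ∑ j, M i j * v j = 0 := congrFun hv i
    rw [Fintype.sum_eq_single (.inr α) (fun j hj => by rw [hi' j hj, zero_mul])] at this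
    exact (mul_eq_zero.mp this).resolve_left hi
  have hv2 : ∀ e, v (.inr (ρ e)) = 0 := by
    have hz : ∑ e, (c e * v (.inr (ρ e))) • wt e = 0 := by
      refine h.ext fun k => ?_
      have := hrow (.inl k)
      simp only [h1, zero_mul, Finset.sum_const_zero, zero_add] at this
      rw [← Fintype.sum_of_injective ρ hρ (fun e => (c e * v (.inr (ρ e))) * wt e (h k)) _
        (fun α hα => by rw [hv1 α hα, mul_zero])
        (fun e => by rw [h2]; ring)] at this
      simpa using this
    intro e
    exact (mul_eq_zero.mp (Fintype.linearIndependent_iff.mp hli _ hz e)).resolve_left (hc e)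
  have hv3 : ∀ α, v (.inr α) = 0 := by
    intro α
    by_cases hα : α ∈ Set.range ρ
    · obtain ⟨e, rfl⟩ := hα
      exact hv2 e
    · exact hv1 α hα
  have hx : ∑ k, v (.inl k) • h k = 0 := by
    rw [← Module.forall_dual_apply_eq_zero_iff K]
    intro φ
    have hφ : φ ∈ Submodule.span K (Set.range wt) := hspan ▸ Submodule.mem_top
    induction hφ using Submodule.span_induction with
    | mem _ hx =>
      obtain ⟨e, rfl⟩ := hx
      have := hrow (.inr (ρ e))
      simp only [h3, hv3, mul_zero, Finset.sum_const_zero, add_zero] at this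
      have hce : c e * ∑ k, v (.inl k) * wt e (h k) = 0 := by
        rw [Finset.mul_sum, ← neg_eq_zero, ← Finset.sum_neg_distrib, ← this]
        exact Finset.sum_congr rfl fun k _ => by ring
      simpa using (mul_eq_zero.mp hce).resolve_left (hc e)
    | zero => rfl
    | add _ _ _ _ h h' => rw [LinearMap.add_apply, h, h', add_zero]
    | smul a _ _ h => rw [LinearMap.smul_apply, h, smul_zero]
  ext (k | α)
  · exact Fintype.linearIndependent_iff.mp h.linearIndependent _ hx k
  · exact hv3 α

end LinearAlgebra

/-! ### Index zero from an invertible matrix -/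

section Index

variable {K 𝔤 : Type*} [Field K] [LieRing 𝔤] [LieAlgebra K 𝔤]

theorem index_eq_zero_of_det_ne_zero {I : Type*} [Fintype I] [DecidableEq I] (v : I → 𝔤)
    (hv : Submodule.span K (Set.range v) = ⊤) (f : Dual K 𝔤)
    (hdet : (Matrix.of fun i j => f ⁅v i, v j⁆).det ≠ 0) : index K 𝔤 = 0 := by
  have hker : LinearMap.ker (bracketForm K 𝔤 f) = ⊥ := by
    rw [LinearMap.ker_eq_bot']
    intro x hx
    have hxv : x ∈ Submodule.span K (Set.range v) := hv ▸ Submodule.mem_top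
    obtain ⟨c, rfl⟩ := (Submodule.mem_span_range_iff_exists_fun K).mp hxv
    have hc : c = 0 := by
      refine Matrix.eq_zero_of_vecMul_eq_zero hdet (funext fun j => ?_)
      have := LinearMap.congr_fun hx (v j)
      simpa [Matrix.vecMul, dotProduct, bracketForm] using this
    simp [hc]
  have : index K 𝔤 ≤ finrank K (LinearMap.ker (bracketForm K 𝔤 f)) := ciInf_le' _ f
  rw [hker, finrank_bot] at this
  omega

end Index

/-! ### Root vectors and the Killing form -/

section RootVectors

variable {K L : Type*} [Field K] [CharZero K] [LieRing L] [LieAlgebra K L] [FiniteDimensional K L]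
  [IsKilling K L] {H : LieSubalgebra K L} [H.IsCartanSubalgebra]
  [LieModule.IsTriangularizable K H L]

/-- Root spaces are lines, so a zero value would make `x` orthogonal to the whole root space of
`-α`, hence to everything. -/
theorem killingForm_ne_zero_of_mem_rootSpace {α : LieModule.Weight K H L} (hα : α.IsNonZero)
    {x y : L} (hx : x ∈ rootSpace H α) (hx0 : x ≠ 0) (hy : y ∈ rootSpace H (-α)) (hy0 : y ≠ 0) :
    killingForm K L x y ≠ 0 := by
  intro h
  refine hx0 ?_
  have hy' : y ∈ rootSpace H (-α : LieModule.Weight K H L) := by simpa using hy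
  have h1 := finrank_rootSpace_eq_one (-α) hα.neg
  have := mem_ker_killingForm_of_mem_rootSpace_of_forall_rootSpace_neg K L H hx fun z hz => by
    have hz' : z ∈ rootSpace H (-α : LieModule.Weight K H L) := by simpa using hz
    obtain ⟨c, hc⟩ := (finrank_eq_one_iff_of_nonzero' (⟨y, hy'⟩ : rootSpace H _)
      (by simpa using hy0)).mp h1 ⟨z, hz'⟩
    have hc' : c • y = z := congrArg Subtype.val hc
    rw [← hc', map_smul, h, smul_zero]
  simpa using this

theorem rootSpace_eq_span_singleton {α : LieModule.Weight K H L} (hα : α.IsNonZero) {x : L}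
    (hx : x ∈ rootSpace H α) (hx0 : x ≠ 0) :
    (rootSpace H α).toSubmodule = Submodule.span K {x} := by
  refine le_antisymm (fun z hz => ?_) (by simpa using hx)
  obtain ⟨c, hc⟩ := (finrank_eq_one_iff_of_nonzero' (⟨x, hx⟩ : rootSpace H _)
    (by simpa using hx0)).mp (finrank_rootSpace_eq_one α hα) ⟨z, hz⟩
  exact Submodule.mem_span_singleton.mpr ⟨c, congrArg Subtype.val hc⟩

/-- A linear form supported on the root space of `α`. -/
theorem exists_dual_rootSpace {α : LieModule.Weight K H L} (hα : α.IsNonZero) :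
    ∃ f : Dual K L, (∀ (χ : H → K), ∀ x ∈ rootSpace H χ, f x ≠ 0 → χ = α) ∧
      (∀ x ∈ rootSpace H α, x ≠ 0 → f x ≠ 0) ∧
      ∀ β γ : LieModule.Weight K H L, γ.IsNonZero → (β + γ : H → K) = α → β (coroot α) ≠ 0 →
        rootSpace H (α + β : H → K) = ⊥ → ∀ x ∈ rootSpace H β, x ≠ 0 → ∀ y ∈ rootSpace H γ,
        y ≠ 0 → f ⁅x, y⁆ ≠ 0 := by
  obtain ⟨h, e, f, ht, he, hf⟩ := exists_isSl2Triple_of_weight_isNonZero hα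
  have hfα : f ∈ rootSpace H (-α : LieModule.Weight K H L) := by simpa using hf
  refine ⟨killingForm K L f, fun χ x hx hne => ?_, fun x hx hx0 => ?_, ?_⟩
  · by_contra hχ
    refine hne (killingForm_apply_eq_zero_of_mem_rootSpace_of_add_ne_zero K L H hf hx ?_)
    rwa [ne_eq, neg_add_eq_zero, eq_comm]
  · exact killingForm_ne_zero_of_mem_rootSpace hα.neg hfα ht.f_ne_zero (by simpa using hx) hx0
  · intro β γ hγ hsum hβ hbot x hx hx0 y hy hy0
    have hex : ⁅e, x⁆ = 0 := by
      have : ⁅e, x⁆ ∈ rootSpace H (α + β : H → K) :=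
        lie_mem_genWeightSpace_of_mem_genWeightSpace he hx
      rwa [hbot, LieSubmodule.mem_bot] at this
    -- Since `[e, x] = 0`, one has `[e, [f, x]] = [h, x] = β(α^∨) x ≠ 0`. Invariance will then turn
    -- `κ(f, [x, y])` into `κ([f, x], y)`.
    have hfx : ⁅f, x⁆ ≠ 0 := by
      intro h0
      have : ⁅e, ⁅f, x⁆⁆ = β (coroot α) • x := by
        rw [leibniz_lie, hex, lie_zero, add_zero, ht.lie_e_f, ht.h_eq_coroot hα he hf]
        exact lie_eq_smul_of_mem_rootSpace hx (coroot α)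
      rw [h0, lie_zero, eq_comm, smul_eq_zero] at this
      exact this.elim hβ hx0
    have hfx' : ⁅f, x⁆ ∈ rootSpace H (-γ : LieModule.Weight K H L) := by
      have : ⁅f, x⁆ ∈ rootSpace H (-α + β : H → K) :=
        lie_mem_genWeightSpace_of_mem_genWeightSpace hf hx
      convert this using 2
      rw [LieModule.Weight.coe_neg, ← hsum]
      abel
    rw [← LieModule.traceForm_apply_lie_apply]
    exact killingForm_ne_zero_of_mem_rootSpace hγ.neg hfx' hfx (by simpa using hy) hy0

end RootVectors

/-! ### Sums equal to `ρ e` along which the absolute height is additive -/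

section PureSums

variable {ι R M N : Type*} [CommRing R] [CharZero R] [AddCommGroup M]
  [Module R M] [AddCommGroup N] [Module R N] {P : RootPairing ι R M N}

omit [CharZero R] in
theorem neg_mem_posRootsOf {T : Set ι} {i : ι} (hi : i ∈ negRootsOf P T) :
    letI := P.indexNeg; -i ∈ posRootsOf P T := by
  change P.root _ ∈ AddSubmonoid.closure _
  simpa using! hi

omit [CharZero R] in
theorem neg_mem_negRootsOf {T : Set ι} {i : ι} (hi : i ∈ posRootsOf P T) :
    letI := P.indexNeg; -i ∈ negRootsOf P T := by
  change -P.root _ ∈ AddSubmonoid.closure _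
  simpa using! hi

theorem natAbs_height_le (b : P.Base) {i j k : ι} (h : P.root k = P.root i + P.root j) :
    (b.height k).natAbs ≤ (b.height i).natAbs + (b.height j).natAbs := by
  rw [b.height_add h]
  exact Int.natAbs_add_le _ _

theorem height_neg_of_mem_negRootsOf (b : P.Base) {T : Set ι} (hT : T ⊆ (b.support : Set ι)) {i : ι}
    (hi : i ∈ negRootsOf P T) : b.height i < 0 := by
  let := P.indexNeg
  have : b.IsPos (-i) := isPos_of_mem_posRootsOf b hT (neg_mem_posRootsOf hi)
  rw [RootPairing.Base.isPos_iff, b.height_reflectionPerm_self] at this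
  omega

/-- If the height is additive in absolute value on a sum of two elements of `R_+^S ∪ R_-^T`, then
these two elements have the same sign. -/
theorem same_sign_of_natAbs_height_add (b : P.Base) {S T : Set ι}
    (hS : S ⊆ (b.support : Set ι)) (hT : T ⊆ (b.support : Set ι)) {i j k : ι}
    (hi : i ∈ posRootsOf P S ∪ negRootsOf P T) (hj : j ∈ posRootsOf P S ∪ negRootsOf P T)
    (h : P.root i + P.root j = P.root k)
    (hn : (b.height i).natAbs + (b.height j).natAbs = (b.height k).natAbs) :
    (i ∈ posRootsOf P S ∧ j ∈ posRootsOf P S ∧ 0 < b.height k) ∨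
      (i ∈ negRootsOf P T ∧ j ∈ negRootsOf P T ∧ b.height k < 0) := by
  have hk := b.height_add h.symm
  have hp : ∀ l ∈ posRootsOf P S, 0 < b.height l := fun l hl => isPos_of_mem_posRootsOf b hS hl
  have hm : ∀ l ∈ negRootsOf P T, b.height l < 0 := fun l hl => height_neg_of_mem_negRootsOf b hT hl
  rcases hi with hi | hi <;> rcases hj with hj | hj
  · have := hp i hi
    have := hp j hj
    exact Or.inl ⟨hi, hj, by omega⟩
  · have := hp i hi
    have := hm j hj
    omega
  · have := hm i hi
    have := hp j hj
    omega
  · have := hm i hi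
    have := hm j hj
    exact Or.inr ⟨hi, hj, by omega⟩

/-- `ρ` is the family of the `ε_K`, `K ∈ 𝒦(S)`, and of the `-ε_L`, `L ∈ 𝒦(T)`. -/
structure IsSignedCascade (P : RootPairing ι R M N) (S T : Set ι)
    (ρ : cascade P S ⊕ cascade P T → ι) : Prop where
  left (C : cascade P S) : IsHighestRoot P C (ρ (.inl C))
  right (C : cascade P T) : ∃ θ, IsHighestRoot P C θ ∧ P.root (ρ (.inr C)) = -P.root θ

namespace IsSignedCascade

variable {S T : Set ι} {ρ : cascade P S ⊕ cascade P T → ι}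

omit [CharZero R] in
theorem left_mem (h : IsSignedCascade P S T ρ) (C : cascade P S) :
    ρ (.inl C) ∈ posRootsOf P S :=
  posRootsOf_mono (IsCascade.subset C.2) ((h.left C).mem_posRootsOf (IsCascade.isConn C.2).nonempty)

omit [CharZero R] in
theorem right_mem (h : IsSignedCascade P S T ρ) (C : cascade P T) :
    ρ (.inr C) ∈ negRootsOf P T := by
  obtain ⟨θ, hθ, hρ⟩ := h.right C
  change -P.root _ ∈ AddSubmonoid.closure _
  rw [hρ, neg_neg]
  exact posRootsOf_mono (IsCascade.subset C.2) (hθ.mem_posRootsOf (IsCascade.isConn C.2).nonempty)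

omit [CharZero R] in
theorem mem (h : IsSignedCascade P S T ρ) (e : cascade P S ⊕ cascade P T) :
    ρ e ∈ posRootsOf P S ∪ negRootsOf P T := by
  rcases e with C | C
  exacts [Or.inl (h.left_mem C), Or.inr (h.right_mem C)]

theorem pure_cases (h : IsSignedCascade P S T ρ) (b : P.Base)
    (hS : S ⊆ (b.support : Set ι)) (hT : T ⊆ (b.support : Set ι)) {i j : ι}
    {e : cascade P S ⊕ cascade P T}
    (hi : i ∈ posRootsOf P S ∪ negRootsOf P T) (hj : j ∈ posRootsOf P S ∪ negRootsOf P T)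
    (hij : P.root i + P.root j = P.root (ρ e))
    (hn : (b.height i).natAbs + (b.height j).natAbs = (b.height (ρ e)).natAbs) :
    (i ∈ posRootsOf P S ∧ j ∈ posRootsOf P S ∧ ∃ C, e = .inl C) ∨
      (i ∈ negRootsOf P T ∧ j ∈ negRootsOf P T ∧ ∃ C, e = .inr C) := by
  rcases same_sign_of_natAbs_height_add b hS hT hi hj hij hn with ⟨h1, h2, h3⟩ | ⟨h1, h2, h3⟩ <;>
    rcases e with C | C
  · exact Or.inl ⟨h1, h2, C, rfl⟩
  · have := height_neg_of_mem_negRootsOf b hT (h.right_mem C)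
    omega
  · have : 0 < b.height _ := isPos_of_mem_posRootsOf b hS (h.left_mem C)
    omega
  · exact Or.inr ⟨h1, h2, C, rfl⟩

variable [Finite ι] [IsDomain R] [P.IsCrystallographic]

/-- The partner `j` is `ρ e - i`; a negative root is treated through its opposite in `R_+^T`. The
last two conclusions are those that `exists_dual_rootSpace` needs for a nonzero matrix entry. -/
theorem exists_pure (h : IsSignedCascade P S T ρ) (b : P.Base)
    (hS : S ⊆ (b.support : Set ι)) (hT : T ⊆ (b.support : Set ι)) {i : ι}
    (hi : i ∈ posRootsOf P S ∪ negRootsOf P T) (hiρ : i ∉ Set.range ρ) :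
    ∃ e, ∃ j ∈ posRootsOf P S ∪ negRootsOf P T, P.root i + P.root j = P.root (ρ e) ∧
      (b.height i).natAbs + (b.height j).natAbs = (b.height (ρ e)).natAbs ∧
      P.pairing i (ρ e) ≠ 0 ∧ P.root (ρ e) + P.root i ∉ Set.range P.root := by
  let := P.indexNeg
  rcases hi with hi | hi
  · obtain ⟨C, θ, hC, hθ, hiθ⟩ := exists_isCascade_eq_or_add_eq b hS
      (fun C hC => ⟨_, h.left ⟨C, hC⟩⟩) hi
    obtain rfl := hθ.unique b (hC.subset.trans hS) (h.left ⟨C, hC⟩)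
    obtain ⟨hpos, hnot, j, hj, hij⟩ := hiθ.resolve_left fun heq => hiρ ⟨_, heq.symm⟩
    refine ⟨_, j, Or.inl hj, hij, ?_, fun h0 => ?_, hnot⟩
    · have hih : 0 < b.height i := isPos_of_mem_posRootsOf b hS hi
      have hjh : 0 < b.height j := isPos_of_mem_posRootsOf b hS hj
      have := b.height_add hij.symm
      omega
    · rw [← P.algebraMap_pairingIn ℤ, FaithfulSMul.algebraMap_eq_zero_iff] at h0
      omega
  · have hi' : -i ∈ posRootsOf P T := neg_mem_posRootsOf hi
    obtain ⟨C, θ, hC, hθ, hiθ⟩ := exists_isCascade_eq_or_add_eq b hT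
      (fun C hC => (h.right ⟨C, hC⟩).imp fun _ h => h.1) hi'
    obtain ⟨θ', hθ', hρ⟩ := h.right ⟨C, hC⟩
    obtain rfl := hθ.unique b (hC.subset.trans hT) hθ'
    have hρ' : ρ (.inr ⟨C, hC⟩) = -θ := P.root.injective (by rw [hρ]; simp)
    obtain ⟨hpos, hnot, j, hj, hij⟩ := hiθ.resolve_left fun heq => hiρ
      ⟨.inr ⟨C, hC⟩, by rw [hρ', ← heq, neg_neg]⟩
    have hj' : -j ∈ negRootsOf P T := neg_mem_negRootsOf hj
    have hij' : P.root i + P.root (-j) = P.root (ρ (.inr ⟨C, hC⟩)) := by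
      rw [hρ, ← hij]
      simp [add_comm]
    refine ⟨.inr ⟨C, hC⟩, -j, Or.inr hj', hij', ?_, fun h0 => ?_, ?_⟩
    · have hih := height_neg_of_mem_negRootsOf b hT hi
      have hjh := height_neg_of_mem_negRootsOf b hT hj'
      have := b.height_add hij'.symm
      omega
    · rw [← P.algebraMap_pairingIn ℤ, FaithfulSMul.algebraMap_eq_zero_iff, hρ'] at h0
      simp at h0 hpos
      omega
    · rw [← P.neg_mem_range_root_iff, hρ]
      simpa [neg_add, add_comm] using hnot

theorem pure_unique (h : IsSignedCascade P S T ρ) (b : P.Base)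
    (hS : S ⊆ (b.support : Set ι)) (hT : T ⊆ (b.support : Set ι)) {i j j' : ι}
    {e e' : cascade P S ⊕ cascade P T} (hi : i ∈ posRootsOf P S ∪ negRootsOf P T)
    (hj : j ∈ posRootsOf P S ∪ negRootsOf P T) (hj' : j' ∈ posRootsOf P S ∪ negRootsOf P T)
    (hij : P.root i + P.root j = P.root (ρ e))
    (hn : (b.height i).natAbs + (b.height j).natAbs = (b.height (ρ e)).natAbs)
    (hij' : P.root i + P.root j' = P.root (ρ e'))
    (hn' : (b.height i).natAbs + (b.height j').natAbs = (b.height (ρ e')).natAbs) :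
    e = e' := by
  let := P.indexNeg
  rcases h.pure_cases b hS hT hi hj hij hn with ⟨h1, h2, C, rfl⟩ | ⟨h1, h2, C, rfl⟩ <;>
    rcases h.pure_cases b hS hT hi hj' hij' hn' with ⟨h3, h4, C', rfl⟩ | ⟨h3, h4, C', rfl⟩
  · rw [Subtype.ext (IsCascade.eq_of_add_eq_of_add_eq b hS C.2 C'.2 (h.left C) (h.left C')
      h1 h2 h4 hij hij')]
  · have : 0 < b.height i := isPos_of_mem_posRootsOf b hS h1
    have := height_neg_of_mem_negRootsOf b hT h3
    omega
  · have : 0 < b.height i := isPos_of_mem_posRootsOf b hS h3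
    have := height_neg_of_mem_negRootsOf b hT h1
    omega
  · obtain ⟨θ, hθ, hρ⟩ := h.right C
    obtain ⟨θ', hθ', hρ'⟩ := h.right C'
    have hneg : ∀ l ∈ negRootsOf P T, -l ∈ posRootsOf P T :=
      fun l hl => neg_mem_posRootsOf hl
    rw [Subtype.ext (IsCascade.eq_of_add_eq_of_add_eq b hT C.2 C'.2 hθ hθ' (hneg i h1) (hneg j h2)
      (hneg j' h4) ?_ ?_)]
    · rw [← neg_eq_iff_eq_neg.mpr hρ, ← hij]
      simp [add_comm]
    · rw [← neg_eq_iff_eq_neg.mpr hρ', ← hij']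
      simp [add_comm]

/-- Members of the family have no partner, so the row of a partner vanishes on the torus columns. -/
theorem not_pure (h : IsSignedCascade P S T ρ) (b : P.Base)
    (hS : S ⊆ (b.support : Set ι)) (hT : T ⊆ (b.support : Set ι)) {j : ι}
    {e e' : cascade P S ⊕ cascade P T} (hj : j ∈ posRootsOf P S ∪ negRootsOf P T)
    (hij : P.root (ρ e') + P.root j = P.root (ρ e)) :
    (b.height (ρ e')).natAbs + (b.height j).natAbs ≠ (b.height (ρ e)).natAbs := by
  let := P.indexNeg
  intro hn
  rcases h.pure_cases b hS hT (h.mem e') hj hij hn with ⟨h1, h2, C, rfl⟩ | ⟨h1, h2, C, rfl⟩ <;>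
    rcases e' with C' | C'
  · exact IsCascade.add_ne b hS C'.2 C.2 (h.left C') (h.left C) h2 hij
  · have : 0 < b.height _ := isPos_of_mem_posRootsOf b hS h1
    have := height_neg_of_mem_negRootsOf b hT (h.right_mem C')
    omega
  · have : 0 < b.height _ := isPos_of_mem_posRootsOf b hS (h.left_mem C')
    have := height_neg_of_mem_negRootsOf b hT h1
    omega
  · obtain ⟨θ, hθ, hρ⟩ := h.right C
    obtain ⟨θ', hθ', hρ'⟩ := h.right C'
    refine IsCascade.add_ne b hT C'.2 C.2 hθ' hθ (j := -j) (neg_mem_posRootsOf h2) ?_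
    rw [← neg_eq_iff_eq_neg.mpr hρ, ← neg_eq_iff_eq_neg.mpr hρ', ← hij]
    simp [add_comm]

end IsSignedCascade

omit [CharZero R] in
/-- If no member of the cascade family vanishes, then every member of the cascades has a highest
root. -/
theorem exists_isSignedCascade {S T : Set ι}
    (hne : ∀ e, cascadeFamily P S T e ≠ 0) : ∃ ρ, IsSignedCascade P S T ρ := by
  -- The default value 0 of `highestRoot` is what lets nonvanishing produce a highest root.
  have key : ∀ C : Set ι, highestRoot P C ≠ 0 → ∃ θ, IsHighestRoot P C θ := fun C hC => by
    by_contra h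
    exact hC (by rw [highestRoot, dif_neg h])
  choose l hl using fun C : cascade P S => key C (hne (.inl C))
  choose r hr using fun C : cascade P T => key C (hne (.inr C))
  exact ⟨Sum.elim l fun C => P.reflectionPerm (r C) (r C),
    hl, fun C => ⟨r C, hr C, by simp⟩⟩

theorem IsSignedCascade.root_eq_smul (b : P.Base) {S T : Set ι} (hS : S ⊆ (b.support : Set ι))
    (hT : T ⊆ (b.support : Set ι)) {ρ : cascade P S ⊕ cascade P T → ι}
    (h : IsSignedCascade P S T ρ) (e : cascade P S ⊕ cascade P T) :
    P.root (ρ e) = (Sum.elim 1 (-1) : cascade P S ⊕ cascade P T → Rˣ) e • cascadeFamily P S T e := by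
  rcases e with C | C
  · have := (h.left C).highestRoot_eq b ((IsCascade.subset C.2).trans hS)
    simp [cascadeFamily, this]
  · obtain ⟨θ, hθ, hρ⟩ := h.right C
    have := hθ.highestRoot_eq b ((IsCascade.subset C.2).trans hT)
    simp [cascadeFamily, this, hρ, Units.smul_def]

end PureSums

/-! ### Invertibility of the bracket matrix -/

section Frobenius

variable {K L : Type*} [Field K] [CharZero K] [LieRing L] [LieAlgebra K L] [FiniteDimensional K L]
  [IsKilling K L] {H : LieSubalgebra K L} [H.IsCartanSubalgebra]
  [LieModule.IsTriangularizable K H L]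

theorem rootSpace_add_eq_bot {α β : H.root}
    (h : (rootSystem H).root α + (rootSystem H).root β ∉ Set.range (rootSystem H).root)
    (h0 : (rootSystem H).root α + (rootSystem H).root β ≠ 0) :
    rootSpace H (((α : LieModule.Weight K H L) : H → K) + (β : LieModule.Weight K H L)) = ⊥ := by
  by_contra hbot
  let γ : LieModule.Weight K H L := ⟨_, hbot⟩
  have hγ : γ ∈ H.root := by
    rw [LieSubalgebra.root, Finset.mem_filter_univ]
    intro hz
    refine h0 (LinearMap.ext fun x => ?_)
    exact congrFun (show (γ : H → K) = 0 from hz) x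
  exact h ⟨⟨γ, hγ⟩, LinearMap.ext fun x => rfl⟩

theorem index_eq_zero_of_isSignedCascade (b : (rootSystem H).Base) {S T : Set H.root}
    (hS : S ⊆ (b.support : Set H.root)) (hT : T ⊆ (b.support : Set H.root))
    {ρ : cascade (rootSystem H) S ⊕ cascade (rootSystem H) T → H.root}
    (hρ : IsSignedCascade (rootSystem H) S T ρ)
    (hli : LinearIndependent K ((rootSystem H).root ∘ ρ))
    (hspan : Submodule.span K (Set.range ((rootSystem H).root ∘ ρ)) = ⊤) :
    index K (seaweed b S T hS hT) = 0 := by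
  classical
  have : Fintype (cascade (rootSystem H) S ⊕ cascade (rootSystem H) T) := Fintype.ofFinite _
  set A : Set H.root := posRootsOf (rootSystem H) S ∪ negRootsOf (rootSystem H) T with hA
  have hnz : ∀ α : H.root, (α : LieModule.Weight K H L).IsNonZero := H.isNonZero_coe_root
  choose x hx hx0 using fun α : H.root => (α : LieModule.Weight K H L).exists_ne_zero
  choose F hF1 hF2 hF3 using fun e => exists_dual_rootSpace (hnz (ρ e))
  let h := Module.finBasis K H
  let v : Fin (finrank K H) ⊕ A → L := Sum.elim (fun k => (h k : L)) (fun α => x α)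
  let wt : Fin (finrank K H) ⊕ A → (H → K) :=
    Sum.elim 0 (fun α => ((α : H.root) : LieModule.Weight K H L))
  have hvwt : ∀ i, v i ∈ rootSpace H (wt i) := by
    rintro (k | α)
    · change (h k : L) ∈ rootSpace H (0 : H → K)
      rw [rootSpace_zero_eq]
      exact (h k).2
    · exact hx α
  have hvq : Submodule.span K (Set.range v) = (seaweed b S T hS hT).toSubmodule := by
    change _ = seaweedSubmodule S T
    have hH : Submodule.span K (Set.range fun k => (h k : L)) = H.toSubmodule := by
      have := congrArg (Submodule.map H.toSubmodule.subtype) h.span_eq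
      rw [Submodule.map_span, ← Set.range_comp, Submodule.map_top, Submodule.range_subtype] at this
      exact this
    have hR : Submodule.span K (Set.range fun α : A => x α) = rootSpaces A := by
      rw [Submodule.span_range_eq_iSup, rootSpaces, iSup_subtype']
      exact iSup_congr fun α => (rootSpace_eq_span_singleton (hnz α) (hx α) (hx0 α)).symm
    rw [seaweedSubmodule, sup_assoc, show v = Sum.elim _ _ from rfl, Set.Sum.elim_range,
      Submodule.span_union, hH, hR, hA]
    simp only [rootSpaces, iSup_union]
  have hvmem : ∀ i, v i ∈ seaweed b S T hS hT := fun i =>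
    hvq.le (Submodule.subset_span (Set.mem_range_self i))
  let n : Fin (finrank K H) ⊕ A → ℕ := Sum.elim 0 (fun α => (b.height α).natAbs)
  let g := fun e => Matrix.of fun i j => F e ⁅v i, v j⁆
  have hg : ∀ e i j, g e i j ≠ 0 → wt i + wt j = (ρ e : LieModule.Weight K H L) := fun e i j hne =>
    hF1 e _ _ (lie_mem_genWeightSpace_of_mem_genWeightSpace (hvwt i) (hvwt j)) hne
  have hroot : ∀ {α β γ : H.root}, (((α : LieModule.Weight K H L) : H → K) +
      (β : LieModule.Weight K H L)) = (γ : LieModule.Weight K H L) →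
      (rootSystem H).root α + (rootSystem H).root β = (rootSystem H).root γ :=
    fun h => LinearMap.ext fun y => congrFun h y
  have hcoe : ∀ {α β : H.root}, ((α : LieModule.Weight K H L) : H → K) =
      (β : LieModule.Weight K H L) → α = β :=
    fun h => Subtype.ext (DFunLike.coe_injective h)
  have hcA : ∀ e, ρ e ∈ A := hρ.mem
  have hinj : Function.Injective ρ := hli.injective.of_comp
  have hnoeq : ∀ e e', ((ρ e : LieModule.Weight K H L) : H → K) = (ρ e' : LieModule.Weight K H L) →
      e = e' := fun e e' h => hinj (hcoe h)
  have hlie : ∀ k α, ⁅(h k : L), x α⁆ = (rootSystem H).root α (h k) • x α := fun k α =>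
    lie_eq_smul_of_mem_rootSpace (hx α) (h k)
  obtain ⟨c, hc⟩ := exists_det_ne_zero g n (fun e => (b.height (ρ e)).natAbs) (by
    rintro e (k | α) (l | β) hne
    · exact absurd (hg e _ _ hne).symm (by simp [wt])
    · have : (β : H.root) = ρ e := hcoe (by simpa [wt] using hg e _ _ hne)
      simp [n, this]
    · have : (α : H.root) = ρ e := hcoe (by simpa [wt] using hg e _ _ hne)
      simp [n, this]
    · exact natAbs_height_le b (hroot (hg e _ _ hne)).symm) (by
    rw [ne_eq, ← Matrix.exists_mulVec_eq_zero_iff]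
    rintro ⟨u, hu0, hu⟩
    refine hu0 (mulVec_injective_of_torus h (fun e => (⟨ρ e, hcA e⟩ : A)) _ hli hspan
      (fun e e' h => hinj (congrArg Subtype.val h)) (fun e => F e (x (ρ e)))
      (fun e => hF2 e _ (hx _) (hx0 _)) _ ?_ ?_ ?_ ?_ u hu)
    · intro k l
      refine Finset.sum_eq_zero fun e _ => ?_
      split_ifs
      · by_contra hne
        exact absurd (hg e _ _ hne).symm (by simp [wt])
      · rfl
    · intro k e
      rw [Matrix.of_apply, Finset.sum_eq_single e, if_pos (by simp [n])]
      · change F e ⁅(h k : L), x (ρ e)⁆ = _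
        rw [hlie, map_smul, smul_eq_mul, mul_comm]
        rfl
      · intro e' _ he'
        split_ifs
        · by_contra hne
          exact he' (hnoeq _ _ (by simpa [wt] using hg e' _ _ hne)).symm
        · rfl
      · simp
    · intro k e
      rw [Matrix.of_apply, Finset.sum_eq_single e, if_pos (by simp [n])]
      · change F e ⁅x (ρ e), (h k : L)⁆ = _
        rw [← lie_skew, hlie, map_neg, map_smul, smul_eq_mul, mul_comm]
        rfl
      · intro e' _ he'
        split_ifs
        · by_contra hne
          exact he' (hnoeq _ _ (by simpa [wt] using hg e' _ _ hne)).symm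
        · rfl
      · simp
    · rintro ⟨α, hα⟩ hαρ
      obtain ⟨e, β, hβ, hsum, hht, hpair, hnot⟩ := hρ.exists_pure b hS hT hα
        (by rintro ⟨e, rfl⟩; exact hαρ ⟨e, rfl⟩)
      rw [add_comm] at hsum hht
      -- The row isolating the column of `α` is that of its partner `β = ρ e - α`.
      refine ⟨.inr ⟨β, hβ⟩, ?_, ?_⟩
      · rw [Matrix.of_apply, Finset.sum_eq_single e]
        · refine ne_of_eq_of_ne (if_pos hht) ?_
          change F e ⁅x β, x α⁆ ≠ 0
          rw [← lie_skew, map_neg, neg_ne_zero]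
          refine hF3 e _ _ (hnz β) ?_ hpair ?_ _ (hx α) (hx0 α) _ (hx β) (hx0 β)
          · rw [add_comm]
            exact funext fun y => LinearMap.congr_fun hsum y
          · refine rootSpace_add_eq_bot hnot fun h0 => ?_
            -- If `ρ e = -α`, additivity of the absolute heights would force `β` to have height 0.
            have hρα := b.height_add_zsmul (i := α) (j := α) (k := ρ e) (z := -2) (by
              rw [eq_neg_of_add_eq_zero_left h0]
              module)
            have := b.height_ne_zero β
            rw [hρα, smul_eq_mul] at hht
            omega
        · intro e' _ he'
          split_ifs with hn
          · by_contra hne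
            exact he' (hρ.pure_unique b hS hT hβ hα hα hsum hht (hroot (hg e' _ _ hne)) hn).symm
          · rfl
        · simp
      · intro j hj
        refine Finset.sum_eq_zero fun e' _ => ?_
        split_ifs with hn
        · by_contra hne
          rcases j with k | ⟨γ, hγ⟩
          · obtain rfl : β = ρ e' := hcoe (by simpa [wt] using hg e' _ _ hne)
            exact hρ.not_pure b hS hT hα hsum hht
          · have hsum' := hroot (hg e' _ _ hne)
            obtain rfl := hρ.pure_unique b hS hT hβ hα hγ hsum hht hsum' hn
            obtain rfl : γ = α := (rootSystem H).root.injective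
              (add_left_cancel (hsum'.trans hsum.symm))
            exact hj rfl
        · rfl)
  refine index_eq_zero_of_det_ne_zero (fun i => (⟨v i, hvmem i⟩ : seaweed b S T hS hT)) ?_
    ((∑ e, c e • F e) ∘ₗ (seaweed b S T hS hT).toSubmodule.subtype) ?_
  · refine Submodule.map_injective_of_injective
      (seaweed b S T hS hT).toSubmodule.injective_subtype ?_
    rw [Submodule.map_span, ← Set.range_comp, Submodule.map_top, Submodule.range_subtype]
    exact hvq
  · convert hc
    ext i j
    simp [g, Matrix.sum_apply]
    rfl


end Frobenius

end Seaweed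

end

theorem mainTheorem7 {K L : Type*} [Field K] [IsAlgClosed K] [CharZero K]
    [LieRing L] [LieAlgebra K L] [FiniteDimensional K L] [LieAlgebra.IsSemisimple K L]
    (H : LieSubalgebra K L) [H.IsCartanSubalgebra]
    (b : (LieAlgebra.IsKilling.rootSystem H).Base)
    (S T : Set H.root)
    (hS : S ⊆ (b.support : Set H.root)) (hT : T ⊆ (b.support : Set H.root))
    (hindep : LinearIndependent K
      (Seaweed.cascadeFamily (LieAlgebra.IsKilling.rootSystem H) S T))
    (hspan : Submodule.span K
      (Set.range (Seaweed.cascadeFamily (LieAlgebra.IsKilling.rootSystem H) S T)) = ⊤) :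
    Seaweed.index K (Seaweed.seaweed b S T hS hT) = 0 := by
  obtain ⟨ρ, hρ⟩ := Seaweed.exists_isSignedCascade fun e => hindep.ne_zero e
  -- Changing the signs of the `ε_L` keeps a basis.
  let B := (Module.Basis.mk hindep hspan.ge).unitsSMul (Sum.elim 1 (-1))
  have hB : ⇑B = (LieAlgebra.IsKilling.rootSystem H).root ∘ ρ := by
    ext1 e
    rw [Function.comp_apply, hρ.root_eq_smul b hS hT]
    simp [B, Module.Basis.unitsSMul_apply]
  exact Seaweed.index_eq_zero_of_isSignedCascade b hS hT hρ (hB ▸ B.linearIndependent) (hB ▸ B.span_eq)
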